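/- For a prime $p$, let $\mathsf{Line}_p$ be the class of functions $f:\mathbb{Z}_p^2\to\{0,1\}$ for which there are $a,b\in\mathbb{Z}_p$ such that, for all $x,y\in\mathbb{Z}_p$, $f(x,y)=1$ if and only if $ax+b=y$. A learner with $n$ samples is a randomized map $A$ from $(\mathbb{Z}_p^2\times\{0,1\})^n$ to functions $\mathbb{Z}_p^2\to\{0,1\}$; its output need not belong to $\mathsf{Line}_p$. It is $(\alpha,\beta)$-differentially private if, for all $S,S'\in(\mathbb{Z}_p^2\times\{0,1\})^n$ that differ in exactly one position and every set $T$ of functions $\mathbb{Z}_p^2\to\{0,1\}$, $\Pr[A(S)\in T]\le e^{\alpha}\Pr[A(S')\in T]+\beta$. It $(\varepsilon,\delta)$-accurately (PAC) learns $\mathsf{Line}_p$ if, for every $f\in\mathsf{Line}_p$ and every probability distribution $\mathcal{D}$ on $\mathbb{Z}_p^2$, given $n$ independent points drawn from $\mathcal{D}$ and labeled by $f$, it outputs, with probability at least $1-\delta$ over the sample and its own randomness, a function $h$ with $\Pr_{z\sim\mathcal{D}}[h(z)\ne f(z)]\le\varepsilon$. **Theorem.** There is a universal constant $K>0$ such that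 for every prime $p$ and all $\varepsilon,\delta,\alpha,\beta\in(0,1/2)$ there are a number of samples $$n\le K\cdot\frac{1}{\varepsilon\alpha}\,\ln\frac1\beta\,\ln\frac1\delta$$ and a learner with $n$ samples that is $(\alpha,\beta)$-differentially private and $(\varepsilon,\delta)$-accurately learns $\mathsf{Line}_p$. -/

import Mathlib

open scoped ENNReal

/-- A labeled example: a point of the domain together with a Boolean label. -/
abbrev LabeledExample (X : Type*) : Type _ := X × Bool

/-- A randomized learning algorithm on `n` labeled examples: it maps every sample to a
probability distribution over Boolean hypotheses on `X` (not necessarily concepts of a class). -/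
abbrev Learner (X : Type*) (n : ℕ) : Type _ := (Fin n → LabeledExample X) → PMF (X → Bool)

/-- Two samples of size `n` are neighboring if they differ in exactly one position. -/
def Neighboring {X : Type*} {n : ℕ} (S S' : Fin n → LabeledExample X) : Prop :=
  ∃ i, S i ≠ S' i ∧ ∀ j, j ≠ i → S j = S' j

/-- `(α, β)`-differential privacy. -/
def IsDifferentiallyPrivate {X : Type*} {n : ℕ} (α β : ℝ) (A : Learner X n) : Prop :=
  ∀ S S' : Fin n → LabeledExample X, Neighboring S S' →
    ∀ T : Set (X → Bool),
      (A S).toOuterMeasure T ≤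
        ENNReal.ofReal (Real.exp α) * (A S').toOuterMeasure T + ENNReal.ofReal β

/-- The joint law of `n` independent draws from a distribution `D` on a finite domain. -/
noncomputable def iidSample {X : Type*} [Fintype X] (D : PMF X) (n : ℕ) : PMF (Fin n → X) :=
  PMF.ofFintype (fun x => ∏ i, D (x i)) (by
    classical
    have h : ∑ a : X, D a = 1 := by
      rw [← tsum_fintype (L := .unconditional X)]
      exact D.tsum_coe
    have h2 := Fintype.sum_pow (fun a : X => D a) n
    rw [h, one_pow] at h2
    exact h2.symm)

/-- The sample obtained by labeling every point according to the concept `f`. -/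
def labelSample {X : Type*} {n : ℕ} (f : X → Bool) (x : Fin n → X) : Fin n → LabeledExample X :=
  fun i => (x i, f (x i))

/-- The prediction error `Pr_{x ∼ D}[f x ≠ h x]`. -/
noncomputable def predictionError {X : Type*} (D : PMF X) (f h : X → Bool) : ℝ≥0∞ :=
  D.toOuterMeasure {x | f x ≠ h x}

/-- The law of the hypothesis output by `A` on `n` i.i.d. examples from `D` labeled by `f`,
over both the choice of the sample and the randomness of `A`. -/
noncomputable def outputLaw {X : Type*} [Fintype X] {n : ℕ} (A : Learner X n)
    (D : PMF X) (f : X → Bool) : PMF (X → Bool) :=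
  (iidSample D n).bind fun x => A (labelSample f x)

/-- `A` learns the concept class `C` with `(ε, δ)`-accuracy in the distribution-independent
(realizable) PAC model over a finite domain. -/
def IsPACLearner {X : Type*} [Fintype X] {n : ℕ} (ε δ : ℝ) (C : Set (X → Bool))
    (A : Learner X n) : Prop :=
  ∀ f ∈ C, ∀ D : PMF X,
    ENNReal.ofReal (1 - δ) ≤
      (outputLaw A D f).toOuterMeasure {h | predictionError D f h ≤ ENNReal.ofReal ε}

/-- The class of (indicator functions of) non-vertical lines `y = a x + b` in the affine plane
over `ℤ/pℤ`. -/
def LineClass (p : ℕ) : Set (ZMod p × ZMod p → Bool) :=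
  {f | ∃ a b : ZMod p, ∀ x y : ZMod p, f (x, y) = true ↔ a * x + b = y}

/-! Two distinct non-vertical lines share at most one point. Hence, if a line is scored by the
positive examples on it, not counting its most frequent point, every line but the true one has score
0 (`lineScore_eq_zero`). Either the true line wins by a wide margin, or almost all positive examples
sit at one point. In the second case that point wins the count of positive examples by a wide
margin, unless positive examples are rare and the zero function is accurate.

A clear winner can be released privately at a cost independent of the number of candidates. Changing
one example moves each score by at most 1, so a margin moves by at most 2 while the winner stays the
same. The winner can change only when the margin is at most 2, where it is never released
(`releaseProb_margin_le`). A margin of order log(1/β)/α makes release certain.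

The sample size is then free of p, provided that accuracy needs no union bound over the deleted
point. `exists_witness_sets` ensures this: three sets fixed before sampling, each of mass at least
ε/3, control all deletions at once, and each needs only a Chernoff bound. -/

/-! ### Winners and margins -/

/-- A maximizer of the score `q`. -/
noncomputable def winner {H : Type*} [Finite H] [Nonempty H] (q : H → ℕ) : H :=
  (Finite.exists_max q).choose

theorem le_winner {H : Type*} [Finite H] [Nonempty H] (q : H → ℕ) (h : H) :
    q h ≤ q (winner q) :=
  (Finite.exists_max q).choose_spec h

open Classical in
/-- The gap between the best and the second best score, truncated at `n`. -/
noncomputable def margin {H : Type*} [Finite H] [Nonempty H] (n : ℕ) (q : H → ℕ) : ℕ :=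
  Nat.findGreatest (fun k => ∀ h, h ≠ winner q → q h + k ≤ q (winner q)) n

open Classical in
theorem add_margin_le {H : Type*} [Finite H] [Nonempty H] (n : ℕ) (q : H → ℕ) {h : H}
    (hh : h ≠ winner q) : q h + margin n q ≤ q (winner q) := by
  have := Nat.findGreatest_spec (P := fun k => ∀ h, h ≠ winner q → q h + k ≤ q (winner q))
    (Nat.zero_le n) (fun h _ => le_winner q h)
  exact this h hh

open Classical in
theorem margin_le {H : Type*} [Finite H] [Nonempty H] (n : ℕ) (q : H → ℕ) : margin n q ≤ n :=
  Nat.findGreatest_le n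

open Classical in
theorem le_margin {H : Type*} [Finite H] [Nonempty H] {n k : ℕ} {q : H → ℕ} (hk : k ≤ n)
    (hq : ∀ h, h ≠ winner q → q h + k ≤ q (winner q)) : k ≤ margin n q :=
  Nat.le_findGreatest hk hq

theorem winner_eq {H : Type*} [Finite H] [Nonempty H] {q : H → ℕ} {w : H}
    (hw : ∀ h, h ≠ w → q h < q w) : winner q = w := by
  by_contra hne
  exact absurd (le_winner q w) (not_le.2 (hw _ hne))

theorem margin_le_margin_add_two {H : Type*} [Finite H] [Nonempty H] (n : ℕ) {q q' : H → ℕ}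
    (h1 : ∀ h, q h ≤ q' h + 1) (h2 : ∀ h, q' h ≤ q h + 1) (hw : winner q = winner q') :
    margin n q ≤ margin n q' + 2 := by
  have : margin n q - 2 ≤ margin n q' := by
    refine le_margin ((Nat.sub_le _ _).trans (margin_le n q)) fun h hh => ?_
    have h3 := add_margin_le n q (h := h) (by rwa [hw])
    have h4 := h2 h
    have h5 := h1 (winner q)
    have h6 := le_winner q' h
    rw [hw] at h3 h5
    omega
  omega

/-- One unit lost by the old winner and one gained by the new one must close the whole gap. -/
theorem margin_le_two {H : Type*} [Finite H] [Nonempty H] (n : ℕ) {q q' : H → ℕ}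
    (h1 : ∀ h, q h ≤ q' h + 1) (h2 : ∀ h, q' h ≤ q h + 1) (hw : winner q ≠ winner q') :
    margin n q ≤ 2 := by
  have h3 := add_margin_le n q hw.symm
  have h4 := h1 (winner q)
  have h5 := h2 (winner q')
  have h6 := le_winner q' (winner q)
  omega

/-! ### The release probability -/

/-- Rounding of a probability that is within `c` of `0` or `1`. -/
noncomputable def roundProb (c t : ℝ) : ℝ := if t ≤ c then 0 else if 1 - t ≤ c then 1 else t

theorem roundProb_mem {c t : ℝ} (ht : t ∈ Set.Icc (0 : ℝ) 1) :
    roundProb c t ∈ Set.Icc (0 : ℝ) 1 := by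
  unfold roundProb
  split_ifs <;> simp_all

/-- This symmetry carries bounds on the release probability over to its complement. -/
theorem roundProb_one_sub {c t : ℝ} (hc : c < 1 / 2) :
    roundProb c (1 - t) = 1 - roundProb c t := by
  unfold roundProb
  split_ifs <;> linarith

theorem roundProb_le {c E t t' : ℝ} (hE : 1 ≤ E) (hE2 : E ≤ 2) (hc : 0 ≤ c) (hc3 : 3 * c < 1)
    (ht : t ∈ Set.Icc (0 : ℝ) 1) (ht' : t' ∈ Set.Icc (0 : ℝ) 1) (h : t ≤ E * t') :
    roundProb c t ≤ E * roundProb c t' + 2 * c := by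
  have h1 := (roundProb_mem (c := c) ht).2
  -- If `t'` is rounded down, then `t` is at most `2 * c`, too small to be rounded up because `3 * c
  -- < 1`. Otherwise rounding does not decrease `t'` and raises `t` by at most `c`.
  by_cases h0 : t' ≤ c
  · have h2 : t ≤ 2 * c := h.trans (mul_le_mul hE2 h0 ht'.1 (by norm_num))
    have h3 : roundProb c t ≤ 2 * c := by
      unfold roundProb
      split_ifs <;> linarith
    have h4 : roundProb c t' = 0 := if_pos h0
    rw [h4]; linarith
  · have h2 : t' ≤ roundProb c t' := by
      unfold roundProb
      rw [if_neg h0]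
      split_ifs <;> linarith [ht'.2]
    have h3 : roundProb c t ≤ t + 2 * c := by
      unfold roundProb
      split_ifs <;> linarith [ht.1]
    nlinarith

/-- The probability of releasing a winner with margin `d`: a logistic function, rounded. -/
noncomputable def releaseProb (a c : ℝ) (d : ℕ) : ℝ :=
  roundProb c (c * Real.exp (a * (d - 2)) / (1 + c * Real.exp (a * (d - 2))))

theorem logistic_mem {x : ℝ} (hx : 0 < x) : x / (1 + x) ∈ Set.Icc (0 : ℝ) 1 :=
  ⟨by positivity, by rw [div_le_one (by positivity)]; linarith⟩

theorem one_sub_logistic {x : ℝ} (hx : 0 < x) : 1 - x / (1 + x) = 1 / (1 + x) := by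
  field_simp
  ring

theorem releaseProb_mem {a c : ℝ} (hc : 0 < c) (d : ℕ) :
    releaseProb a c d ∈ Set.Icc (0 : ℝ) 1 :=
  roundProb_mem (logistic_mem (by positivity))

/-- Up to margin 2 the odds are at most `c`, hence so is the probability, and rounding makes it
exactly 0. -/
theorem releaseProb_eq_zero {a c : ℝ} (ha : 0 ≤ a) (hc : 0 < c) {d : ℕ} (hd : d ≤ 2) :
    releaseProb a c d = 0 := by
  have hd' : (d : ℝ) ≤ 2 := by exact_mod_cast hd
  have h1 : Real.exp (a * (d - 2)) ≤ 1 :=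
    Real.exp_le_one_iff.2 (mul_nonpos_of_nonneg_of_nonpos ha (by linarith))
  have h2 := Real.exp_pos (a * (d - 2))
  refine if_pos ?_
  rw [div_le_iff₀ (by positivity)]
  nlinarith [mul_pos hc h2]

/-- From this margin on the odds are at least `1 / c`, so the complement is at most `c` and is
rounded away. -/
theorem releaseProb_eq_one {a c : ℝ} (ha : 0 < a) (hc : 0 < c) (hc2 : c < 1 / 2) {d : ℕ}
    (hd : 2 + 2 * Real.log (1 / c) / a ≤ d) : releaseProb a c d = 1 := by
  have h1 : 1 / c * (1 / c) ≤ Real.exp (a * (d - 2)) := by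
    have h2 : 2 * Real.log (1 / c) ≤ a * (d - 2) := by
      have := mul_le_mul_of_nonneg_left hd ha.le
      have h3 : a * (2 + 2 * Real.log (1 / c) / a) = 2 * a + 2 * Real.log (1 / c) := by
        field_simp
      linarith
    calc 1 / c * (1 / c) = Real.exp (Real.log (1 / c) + Real.log (1 / c)) := by
          rw [Real.exp_add, Real.exp_log (by positivity)]
      _ ≤ _ := Real.exp_le_exp.2 (by linarith)
  have h4 : 1 / c ≤ c * Real.exp (a * (d - 2)) := by
    calc 1 / c = c * (1 / c * (1 / c)) := by field_simp
      _ ≤ _ := mul_le_mul_of_nonneg_left h1 hc.le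
  have hx : 0 < c * Real.exp (a * (d - 2)) := by positivity
  have h5 : 1 - c * Real.exp (a * (d - 2)) / (1 + c * Real.exp (a * (d - 2))) ≤ c := by
    rw [one_sub_logistic hx, div_le_iff₀ (by positivity)]
    have : 1 = c * (1 / c) := by field_simp
    nlinarith
  unfold releaseProb roundProb
  rw [if_neg (by linarith), if_pos h5]

theorem logistic_le {x x' E : ℝ} (hx : 0 < x) (hx' : 0 < x') (hE : 1 ≤ E) (h : x ≤ E * x') :
    x / (1 + x) ≤ E * (x' / (1 + x')) := by
  rw [← mul_div_assoc, div_le_div_iff₀ (by positivity) (by positivity)]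
  nlinarith [mul_pos hx hx']

theorem one_sub_logistic_le {x x' E : ℝ} (hx : 0 < x) (hx' : 0 < x') (hE : 1 ≤ E)
    (h : x' ≤ E * x) : 1 - x / (1 + x) ≤ E * (1 - x' / (1 + x')) := by
  rw [one_sub_logistic hx, one_sub_logistic hx', ← mul_div_assoc,
    div_le_div_iff₀ (by positivity) (by positivity)]
  nlinarith

theorem mul_exp_le_mul_exp {a c : ℝ} (ha : 0 ≤ a) (hc : 0 < c) {d d' : ℕ} (h : d ≤ d' + 2) :
    c * Real.exp (a * (d - 2)) ≤ Real.exp (2 * a) * (c * Real.exp (a * (d' - 2))) := by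
  have h' : (d : ℝ) ≤ d' + 2 := by exact_mod_cast h
  calc c * Real.exp (a * (d - 2)) ≤ c * Real.exp (2 * a + a * (d' - 2)) := by
        refine mul_le_mul_of_nonneg_left (Real.exp_le_exp.2 ?_) hc.le
        nlinarith
    _ = _ := by rw [Real.exp_add]; ring

theorem releaseProb_le {a c : ℝ} (ha : 0 ≤ a) (hE : Real.exp (2 * a) ≤ 2) (hc : 0 < c)
    (hc3 : 3 * c < 1) {d d' : ℕ} (h : d ≤ d' + 2) :
    releaseProb a c d ≤ Real.exp (2 * a) * releaseProb a c d' + 2 * c :=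
  roundProb_le (Real.one_le_exp (by positivity)) hE hc.le hc3 (logistic_mem (by positivity))
    (logistic_mem (by positivity))
    (logistic_le (by positivity) (by positivity) (Real.one_le_exp (by positivity))
      (mul_exp_le_mul_exp ha hc h))

theorem one_sub_releaseProb_le {a c : ℝ} (ha : 0 ≤ a) (hE : Real.exp (2 * a) ≤ 2) (hc : 0 < c)
    (hc3 : 3 * c < 1) {d d' : ℕ} (h : d' ≤ d + 2) :
    1 - releaseProb a c d ≤ Real.exp (2 * a) * (1 - releaseProb a c d') + 2 * c := by
  unfold releaseProb
  rw [← roundProb_one_sub (by linarith), ← roundProb_one_sub (by linarith)]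
  have key : ∀ x : ℝ, 0 < x → 1 - x / (1 + x) ∈ Set.Icc (0 : ℝ) 1 := fun x hx =>
    ⟨sub_nonneg.2 (logistic_mem hx).2, by linarith [(logistic_mem hx).1]⟩
  exact roundProb_le (Real.one_le_exp (by positivity)) hE hc.le hc3 (key _ (by positivity))
    (key _ (by positivity))
    (one_sub_logistic_le (by positivity) (by positivity) (Real.one_le_exp (by positivity))
      (mul_exp_le_mul_exp ha hc h))

/-! ### Mixtures and composition of privacy -/

/-- Output `y` with probability `t`, and otherwise a draw from `B`. -/
noncomputable def mixPure {Y : Type*} (t : ℝ) (ht : t ∈ Set.Icc (0 : ℝ) 1) (y : Y) (B : PMF Y) :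
    PMF Y :=
  (PMF.ofFintype (fun b : Bool => ENNReal.ofReal (if b then t else 1 - t)) (by
    rw [Fintype.sum_bool, ← ENNReal.ofReal_add] <;> simp [ht.1, ht.2])).bind
    fun b => if b then PMF.pure y else B

theorem mixPure_toOuterMeasure {Y : Type*} {t : ℝ} (ht : t ∈ Set.Icc (0 : ℝ) 1) (y : Y)
    (B : PMF Y) (T : Set Y) :
    (mixPure t ht y B).toOuterMeasure T =
      ENNReal.ofReal t * (PMF.pure y).toOuterMeasure T +
        ENNReal.ofReal (1 - t) * B.toOuterMeasure T := by
  rw [mixPure, PMF.toOuterMeasure_bind_apply, tsum_fintype, Fintype.sum_bool]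
  simp

theorem mem_of_mem_support_mixPure {Y : Type*} {t : ℝ} (ht : t ∈ Set.Icc (0 : ℝ) 1) {y h : Y}
    {B : PMF Y} (hh : h ∈ (mixPure t ht y B).support) :
    (t ≠ 0 ∧ h = y) ∨ (t ≠ 1 ∧ h ∈ B.support) := by
  rw [mixPure, PMF.mem_support_bind_iff] at hh
  obtain ⟨b, hb, hh⟩ := hh
  rw [PMF.mem_support_iff, PMF.ofFintype_apply] at hb
  cases b
  · right
    refine ⟨?_, by simpa using hh⟩
    rintro rfl
    simp at hb
  · left
    refine ⟨?_, by simpa using hh⟩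
    rintro rfl
    simp at hb

/-- Composition: the fallback costs `(a, b)` and the decision to release costs `(s, c)`. The
released values must agree only if release is possible. The error `c` is paid once on the released
mass and once, scaled by `exp a`, on the fallback. -/
theorem mixPure_toOuterMeasure_le {Y : Type*} {a b s c t t' : ℝ} (ha : 0 ≤ a) (hb : 0 ≤ b)
    (hs : 0 ≤ s) (hc : 0 ≤ c)
    (ht : t ∈ Set.Icc (0 : ℝ) 1) (ht' : t' ∈ Set.Icc (0 : ℝ) 1) {y y' : Y} {B B' : PMF Y}
    {T : Set Y} (hy : y = y' ∨ t = 0)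
    (h1 : t ≤ Real.exp s * t' + c) (h2 : 1 - t ≤ Real.exp s * (1 - t') + c)
    (hB : B.toOuterMeasure T ≤ ENNReal.ofReal (Real.exp a) * B'.toOuterMeasure T +
      ENNReal.ofReal b) :
    (mixPure t ht y B).toOuterMeasure T ≤
      ENNReal.ofReal (Real.exp (a + s)) * (mixPure t' ht' y' B').toOuterMeasure T +
        ENNReal.ofReal (b + c * (1 + Real.exp a)) := by
  have hle : ∀ P : PMF Y, P.toOuterMeasure T ≤ 1 := fun P =>
    (P.toOuterMeasure.mono (Set.subset_univ T)).trans_eq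
      ((P.toOuterMeasure_apply_eq_one_iff _).2 (Set.subset_univ _))
  have hcoe : ∀ P : PMF Y, ∃ r : ℝ, 0 ≤ r ∧ r ≤ 1 ∧ P.toOuterMeasure T = ENNReal.ofReal r := by
    intro P
    refine ⟨(P.toOuterMeasure T).toReal, ENNReal.toReal_nonneg,
      ENNReal.toReal_le_of_le_ofReal zero_le_one (by simpa using hle P), ?_⟩
    rw [ENNReal.ofReal_toReal (ne_top_of_le_ne_top ENNReal.one_ne_top (hle P))]
  rw [mixPure_toOuterMeasure, mixPure_toOuterMeasure]
  obtain ⟨u, hu0, hu1, hu⟩ := hcoe (PMF.pure y)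
  obtain ⟨u', hu0', hu1', hu'⟩ := hcoe (PMF.pure y')
  obtain ⟨v, hv0, hv1, hv⟩ := hcoe B
  obtain ⟨v', hv0', hv1', hv'⟩ := hcoe B'
  have hyu : u = u' ∨ t = 0 := by
    refine hy.imp_left ?_
    rintro rfl
    exact (ENNReal.ofReal_eq_ofReal_iff hu0 hu0').1 (hu ▸ hu')
  rw [hv, hv'] at hB
  rw [hu, hu', hv, hv']
  have ht0 := ht.1
  have ht1 := sub_nonneg.2 ht.2
  have ht0' := ht'.1
  have ht1' := sub_nonneg.2 ht'.2
  have hA := Real.exp_pos a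
  have hS := Real.exp_pos s
  rw [← ENNReal.ofReal_mul hA.le, ← ENNReal.ofReal_add (by positivity) hb,
    ENNReal.ofReal_le_ofReal_iff (by positivity)] at hB
  rw [← ENNReal.ofReal_mul ht0, ← ENNReal.ofReal_mul ht1, ← ENNReal.ofReal_mul ht0',
    ← ENNReal.ofReal_mul ht1', ← ENNReal.ofReal_add (by positivity) (by positivity),
    ← ENNReal.ofReal_add (by positivity) (by positivity), ← ENNReal.ofReal_mul (by positivity),
    ← ENNReal.ofReal_add (by positivity) (by positivity)]
  refine ENNReal.ofReal_le_ofReal ?_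
  have hA1 : 1 ≤ Real.exp a := Real.one_le_exp ha
  have hS1 : 1 ≤ Real.exp s := Real.one_le_exp hs
  have e1 : t * u ≤ Real.exp a * Real.exp s * (t' * u') + c := by
    rcases hyu with rfl | rfl
    · have e2 : t * u ≤ (Real.exp s * t' + c) * u := mul_le_mul_of_nonneg_right h1 hu0
      have e3 : Real.exp s * (t' * u) ≤ Real.exp a * (Real.exp s * (t' * u)) :=
        le_mul_of_one_le_left (by positivity) hA1
      have e4 : c * u ≤ c := mul_le_of_le_one_right hc hu1
      linarith
    · rw [zero_mul]; positivity
  have e2 : (1 - t) * v ≤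
      Real.exp a * Real.exp s * ((1 - t') * v') + c * Real.exp a + b := by
    have e3 : (1 - t) * v ≤ (1 - t) * (Real.exp a * v') + b := by
      have := mul_le_mul_of_nonneg_left hB ht1
      have e4 : (1 - t) * b ≤ b := mul_le_of_le_one_left hb (by linarith)
      linarith
    have e5 : (1 - t) * (Real.exp a * v') ≤
        (Real.exp s * (1 - t') + c) * (Real.exp a * v') :=
      mul_le_mul_of_nonneg_right h2 (by positivity)
    have e6 : c * Real.exp a * v' ≤ c * Real.exp a :=
      mul_le_of_le_one_right (by positivity) hv1'
    linarith
  rw [Real.exp_add]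
  linarith

/-! ### Counts and scores of samples -/

open Classical in
/-- The number of entries of `S` that satisfy `Q`. -/
noncomputable def countOn {E : Type*} {n : ℕ} (Q : E → Prop) (S : Fin n → E) : ℕ :=
  (Finset.univ.filter fun i => Q (S i)).card

theorem countOn_mono {E E' : Type*} {n : ℕ} {Q : E → Prop} {R : E' → Prop} {S : Fin n → E}
    {S' : Fin n → E'} (h : ∀ i, Q (S i) → R (S' i)) : countOn Q S ≤ countOn R S' := by
  classical
  exact Finset.card_le_card (Finset.monotone_filter_right _ fun i _ => h i)

theorem countOn_le {E : Type*} {n : ℕ} (Q : E → Prop) (S : Fin n → E) : countOn Q S ≤ n := by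
  classical
  exact (Finset.card_le_univ _).trans_eq (Fintype.card_fin n)

theorem countOn_le_add {E : Type*} {n : ℕ} {P Q R : E → Prop} (S : Fin n → E)
    (h : ∀ i, P (S i) → Q (S i) ∨ R (S i)) : countOn P S ≤ countOn Q S + countOn R S := by
  classical
  refine le_trans (Finset.card_le_card ?_) (Finset.card_union_le _ _)
  intro i hi
  simp only [Finset.mem_union, Finset.mem_filter, Finset.mem_univ, true_and] at hi ⊢
  exact h i hi

theorem countOn_eq_zero {E : Type*} {n : ℕ} {Q : E → Prop} {S : Fin n → E}
    (h : ∀ i, ¬ Q (S i)) : countOn Q S = 0 := by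
  classical
  exact Finset.card_eq_zero.2 (Finset.filter_eq_empty_iff.2 fun i _ => h i)

theorem Neighboring.symm {X : Type*} {n : ℕ} {S S' : Fin n → LabeledExample X}
    (h : Neighboring S S') : Neighboring S' S := by
  obtain ⟨i, hi, hj⟩ := h
  exact ⟨i, hi.symm, fun j h => (hj j h).symm⟩

theorem Neighboring.countOn_le {X : Type*} {n : ℕ} {S S' : Fin n → LabeledExample X}
    (h : Neighboring S S') (Q : LabeledExample X → Prop) : countOn Q S ≤ countOn Q S' + 1 := by
  classical
  obtain ⟨i, -, hj⟩ := h
  refine le_trans (Finset.card_le_card ?_) (Finset.card_insert_le i _)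
  intro j hQ
  rw [Finset.mem_filter] at hQ
  rw [Finset.mem_insert]
  by_cases hji : j = i
  · exact Or.inl hji
  · exact Or.inr (Finset.mem_filter.2 ⟨hQ.1, hj j hji ▸ hQ.2⟩)

/-- The number of positive examples on the line `y = h.1 * x + h.2`, disregarding the most
frequent point. -/
noncomputable def lineScore {F : Type*} [Field F] {n : ℕ} (S : Fin n → LabeledExample (F × F))
    (h : F × F) : ℕ :=
  ⨅ z : F × F, countOn (fun e => e.2 = true ∧ h.1 * e.1.1 + h.2 = e.1.2 ∧ e.1 ≠ z) S

/-- The number of positive examples at the point `z`. -/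
noncomputable def pointScore {X : Type*} {n : ℕ} (S : Fin n → LabeledExample X) (z : X) : ℕ :=
  countOn (fun e => e.2 = true ∧ e.1 = z) S

theorem Neighboring.pointScore_le {X : Type*} {n : ℕ} {S S' : Fin n → LabeledExample X}
    (h : Neighboring S S') (z : X) : pointScore S z ≤ pointScore S' z + 1 :=
  h.countOn_le _

theorem Neighboring.lineScore_le {F : Type*} [Field F] {n : ℕ}
    {S S' : Fin n → LabeledExample (F × F)} (h : Neighboring S S') (l : F × F) :
    lineScore S l ≤ lineScore S' l + 1 := by
  obtain ⟨z, hz⟩ := ciInf_mem fun z : F × F =>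
    countOn (fun e => e.2 = true ∧ l.1 * e.1.1 + l.2 = e.1.2 ∧ e.1 ≠ z) S'
  have h1 : lineScore S l ≤
      countOn (fun e => e.2 = true ∧ l.1 * e.1.1 + l.2 = e.1.2 ∧ e.1 ≠ z) S :=
    ciInf_le (OrderBot.bddBelow _) z
  refine h1.trans ((h.countOn_le _).trans_eq ?_)
  rw [lineScore, ← hz]

/-! ### The learner and its privacy -/

open Classical in
/-- The indicator function of the line `y = h.1 * x + h.2`. -/
noncomputable def lineIndicator {F : Type*} [Field F] (h : F × F) : F × F → Bool :=
  fun x => decide (h.1 * x.1 + h.2 = x.2)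

open Classical in
/-- The indicator function of a point. -/
noncomputable def pointIndicator {X : Type*} (z : X) : X → Bool := fun x => decide (x = z)

/-- Release the best line if its margin is large; otherwise release the best point if its margin
is large; otherwise output the zero function. -/
noncomputable def lineLearner (F : Type*) [Field F] [Finite F] (n : ℕ) (a : ℝ) {c : ℝ}
    (hc : 0 < c) : Learner (F × F) n := fun S =>
  mixPure (releaseProb a c (margin n (lineScore S))) (releaseProb_mem hc _)
    (lineIndicator (winner (lineScore S)))
    (mixPure (releaseProb a c (margin n (pointScore S))) (releaseProb_mem hc _)
      (pointIndicator (winner (pointScore S))) (PMF.pure fun _ => false))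

theorem releaseProb_margin_le {H : Type*} [Finite H] [Nonempty H] (n : ℕ) {a c : ℝ} (ha : 0 ≤ a)
    (hE : Real.exp (2 * a) ≤ 2) (hc : 0 < c) (hc3 : 3 * c < 1) {q q' : H → ℕ}
    (h1 : ∀ h, q h ≤ q' h + 1) (h2 : ∀ h, q' h ≤ q h + 1) :
    (winner q = winner q' ∨ releaseProb a c (margin n q) = 0) ∧
      releaseProb a c (margin n q) ≤
        Real.exp (2 * a) * releaseProb a c (margin n q') + 2 * c ∧
      1 - releaseProb a c (margin n q) ≤
        Real.exp (2 * a) * (1 - releaseProb a c (margin n q')) + 2 * c := by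
  by_cases hw : winner q = winner q'
  · exact ⟨Or.inl hw, releaseProb_le ha hE hc hc3 (margin_le_margin_add_two n h1 h2 hw),
      one_sub_releaseProb_le ha hE hc hc3 (margin_le_margin_add_two n h2 h1 hw.symm)⟩
  · have e1 := releaseProb_eq_zero ha hc (margin_le_two n h1 h2 hw)
    have e2 := releaseProb_eq_zero ha hc (margin_le_two n h2 h1 (Ne.symm hw))
    rw [e1, e2]
    have := Real.one_le_exp (x := 2 * a) (by positivity)
    refine ⟨Or.inr rfl, ?_, ?_⟩ <;> linarith

theorem lineLearner_isDifferentiallyPrivate (F : Type*) [Field F] [Finite F] (n : ℕ) {a c : ℝ}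
    (hc : 0 < c) (ha : 0 ≤ a) (hE : Real.exp (2 * a) ≤ 2) (hc3 : 3 * c < 1) :
    IsDifferentiallyPrivate (4 * a) (10 * c) (lineLearner F n a hc) := by
  intro S S' hS T
  obtain ⟨l1, l2, l3⟩ := releaseProb_margin_le n ha hE hc hc3 hS.lineScore_le hS.symm.lineScore_le
  obtain ⟨p1, p2, p3⟩ :=
    releaseProb_margin_le n ha hE hc hc3 hS.pointScore_le hS.symm.pointScore_le
  have h1 := mixPure_toOuterMeasure_le (T := T) (B := PMF.pure fun _ => false)
    (B' := PMF.pure fun _ => false) le_rfl le_rfl (by positivity) (by positivity)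
    (releaseProb_mem hc _) (releaseProb_mem hc _) (p1.imp_left (congrArg pointIndicator)) p2 p3
    (by simp)
  have h2 := mixPure_toOuterMeasure_le (by positivity) (by positivity) (by positivity)
    (by positivity) (releaseProb_mem hc _) (releaseProb_mem hc _)
    (l1.imp_left (congrArg lineIndicator)) l2 l3 h1
  refine h2.trans (add_le_add (mul_le_mul_left ?_ _) ?_)
  · exact ENNReal.ofReal_le_ofReal (Real.exp_le_exp.2 (by linarith))
  · refine ENNReal.ofReal_le_ofReal ?_
    -- The inner mixture contributes `4 * c`, the outer one `2 * c * (1 + exp (2 * a))`, at most `6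
    -- * c`.
    rw [Real.exp_zero, zero_add (2 * a)]
    nlinarith

/-! ### A Chernoff bound -/

theorem toOuterMeasure_univ {X : Type*} (P : PMF X) : P.toOuterMeasure Set.univ = 1 :=
  (P.toOuterMeasure_apply_eq_one_iff _).2 (Set.subset_univ _)

-- One factor of the Chernoff bound: the mean of 2 to the power of minus the indicator of `A` is 1 -
-- D(A)/2, and 1 - r/2 ≤ exp(-r/2).
open Classical in
theorem sum_mul_half_le {X : Type*} [Fintype X] (D : PMF X) {A : Set X} {r : ℝ} (hr : 0 ≤ r)
    (hA : ENNReal.ofReal r ≤ D.toOuterMeasure A) :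
    ∑ a, D a * (if a ∈ A then 2⁻¹ else 1) ≤ ENNReal.ofReal (Real.exp (-(r / 2))) := by
  have h1 : ∑ a, D a = 1 := by rw [← tsum_fintype (L := .unconditional X)]; exact D.tsum_coe
  have h2 : ∑ a, D a * (if a ∈ A then (2⁻¹ : ℝ≥0∞) else 1) + D.toOuterMeasure A * 2⁻¹ = 1 := by
    rw [PMF.toOuterMeasure_apply_fintype, Finset.sum_mul, ← Finset.sum_add_distrib]
    refine Eq.trans ?_ h1
    refine Finset.sum_congr rfl fun a _ => ?_
    by_cases ha : a ∈ A
    · rw [Set.indicator_of_mem ha, if_pos ha, ← mul_add, ENNReal.inv_two_add_inv_two, mul_one]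
    · rw [Set.indicator_of_notMem ha, if_neg ha, mul_one, zero_mul, add_zero]
  have h3 : ENNReal.ofReal (r / 2) ≤ D.toOuterMeasure A * 2⁻¹ := by
    rw [div_eq_mul_inv, ENNReal.ofReal_mul hr, ENNReal.ofReal_inv_of_pos (by norm_num),
      ENNReal.ofReal_ofNat]
    gcongr
  calc _ ≤ 1 - ENNReal.ofReal (r / 2) := by
        refine ENNReal.le_sub_of_add_le_right ENNReal.ofReal_ne_top ?_
        exact (add_le_add_right h3 _).trans_eq h2
    _ = ENNReal.ofReal (1 - r / 2) := by
        rw [ENNReal.ofReal_sub _ (by positivity), ENNReal.ofReal_one]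
    _ ≤ _ := ENNReal.ofReal_le_ofReal (by linarith [Real.add_one_le_exp (-(r / 2))])

/-- A Chernoff bound for the lower tail. -/
theorem iidSample_countOn_lt_le {X : Type*} [Fintype X] (D : PMF X) (n m : ℕ) {A : Set X} {r : ℝ}
    (hr : 0 ≤ r) (hA : ENNReal.ofReal r ≤ D.toOuterMeasure A) :
    (iidSample D n).toOuterMeasure {x | countOn (· ∈ A) x < m} ≤
      ENNReal.ofReal (2 ^ m * Real.exp (-(n * r / 2))) := by
  classical
  -- The indicator of the event is at most 2^(m - count), which factors over the draws.
  have h1 : ∀ x : Fin n → X, ({x | countOn (· ∈ A) x < m} : Set (Fin n → X)).indicator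
      (iidSample D n) x ≤ 2 ^ m * ∏ i, (D (x i) * (if x i ∈ A then 2⁻¹ else 1)) := by
    intro x
    by_cases hx : countOn (· ∈ A) x < m
    · rw [Set.indicator_of_mem (by exact hx), iidSample, PMF.ofFintype_apply,
        Finset.prod_mul_distrib, Finset.prod_ite, Finset.prod_const, Finset.prod_const_one,
        mul_one, mul_left_comm]
      refine le_mul_of_one_le_right' ?_
      have h2 : (Finset.univ.filter fun i => x i ∈ A).card ≤ m := by
        unfold countOn at hx
        convert hx.le
      obtain ⟨k, hk⟩ := Nat.exists_eq_add_of_le h2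
      rw [hk, pow_add, mul_right_comm, ← mul_pow,
        ENNReal.mul_inv_cancel (by norm_num) (by norm_num), one_pow, one_mul]
      exact one_le_pow₀ (by norm_num)
    · rw [Set.indicator_of_notMem (by exact hx)]
      exact bot_le
  rw [PMF.toOuterMeasure_apply_fintype]
  calc _ ≤ ∑ x : Fin n → X, 2 ^ m * ∏ i, (D (x i) * (if x i ∈ A then (2⁻¹ : ℝ≥0∞) else 1)) :=
        Finset.sum_le_sum fun x _ => h1 x
    _ = 2 ^ m * (∑ a, D a * (if a ∈ A then (2⁻¹ : ℝ≥0∞) else 1)) ^ n := by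
        rw [← Finset.mul_sum, Fintype.sum_pow]
    _ ≤ 2 ^ m * (ENNReal.ofReal (Real.exp (-(r / 2)))) ^ n := by
        gcongr
        exact sum_mul_half_le D hr hA
    _ = _ := by
        rw [ENNReal.ofReal_mul (by positivity), ENNReal.ofReal_pow (by norm_num),
          ENNReal.ofReal_ofNat, ← ENNReal.ofReal_pow (by positivity), ← Real.exp_nat_mul]
        congr 3
        ring_nf

/-! ### Witness sets for all punctured lines -/

/-- A set of mass above `3 e` contains two disjoint subsets of mass at least `e`, unless it is,
up to mass `2 e`, a single point. -/
theorem exists_disjoint_or_singleton {X : Type*} [Finite X] (D : PMF X) {L : Set X} {e : ℝ≥0∞}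
    (he0 : e ≠ 0) (hL : 3 * e < D.toOuterMeasure L) :
    (∃ A ⊆ L, ∃ B ⊆ L, Disjoint A B ∧ e ≤ D.toOuterMeasure A ∧ e ≤ D.toOuterMeasure B) ∨
      ∃ z ∈ L, e ≤ D.toOuterMeasure {z} ∧ D.toOuterMeasure (L \ {z}) ≤ 3 * e := by
  have hL1 : e ≤ D.toOuterMeasure L :=
    le_trans (le_mul_of_one_le_left' (by norm_num)) hL.le
  -- If the rest of `L` is light, minimality makes `A` minus any of its points `z` light as well, so
  -- `z` carries the mass of `L` up to `2 * e`.
  obtain ⟨A, hA⟩ := Set.Finite.exists_minimal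
    (Set.toFinite {A : Set X | A ⊆ L ∧ e ≤ D.toOuterMeasure A}) ⟨L, subset_rfl, hL1⟩
  obtain ⟨hAL, hAe⟩ := hA.prop
  by_cases hB : e ≤ D.toOuterMeasure (L \ A)
  · exact Or.inl ⟨A, hAL, L \ A, Set.sdiff_subset, Set.disjoint_sdiff_right, hAe, hB⟩
  right
  push Not at hB
  obtain ⟨z, hz⟩ : A.Nonempty := by
    rw [Set.nonempty_iff_ne_empty]
    rintro rfl
    rw [MeasureTheory.measure_empty] at hAe
    exact he0 (le_antisymm hAe (bot_le))
  have hAz : D.toOuterMeasure (A \ {z}) < e := by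
    by_contra! h
    have h1 := hA.le_of_le ⟨Set.sdiff_subset.trans hAL, h⟩ Set.sdiff_subset
    exact (h1 hz).2 rfl
  have h1 : D.toOuterMeasure (L \ {z}) ≤ e + e := by
    calc _ ≤ D.toOuterMeasure (A \ {z} ∪ L \ A) := by
          refine D.toOuterMeasure.mono fun x hx => ?_
          by_cases hxA : x ∈ A
          · exact Or.inl ⟨hxA, hx.2⟩
          · exact Or.inr ⟨hx.1, hxA⟩
      _ ≤ _ := MeasureTheory.measure_union_le _ _
      _ ≤ _ := add_le_add hAz.le hB.le
  have h3 : (3 : ℝ≥0∞) * e = e + (e + e) := by ring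
  refine ⟨z, hAL hz, ?_, ?_⟩
  · by_contra! h
    refine absurd hL (not_lt.2 ?_)
    calc _ ≤ D.toOuterMeasure ({z} ∪ L \ {z}) := by
          refine D.toOuterMeasure.mono fun x hx => ?_
          by_cases hxz : x = z
          · exact Or.inl hxz
          · exact Or.inr ⟨hx, hxz⟩
      _ ≤ _ := MeasureTheory.measure_union_le _ _
      _ ≤ 3 * e := by
          rw [h3]
          exact add_le_add h.le h1
  · rw [h3]
    exact h1.trans le_add_self

/-- Three sets of mass at least `e` that witness that a sample represents `L` and all sets
`L \ {z}`. -/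
theorem exists_witness_sets {X : Type*} [Finite X] (D : PMF X) (L : Set X) {e : ℝ≥0∞}
    (he : 3 * e ≤ 1) (he0 : e ≠ 0) :
    ∃ A B C : Set X, e ≤ D.toOuterMeasure A ∧ e ≤ D.toOuterMeasure B ∧ e ≤ D.toOuterMeasure C ∧
      ∀ {n : ℕ} (m : ℕ) (x : Fin n → X),
        m ≤ countOn (· ∈ A) x → m ≤ countOn (· ∈ B) x → m ≤ countOn (· ∈ C) x →
        (D.toOuterMeasure L ≤ 3 * e ∨ m ≤ countOn (· ∈ L) x) ∧
        ∀ z, D.toOuterMeasure (L \ {z}) ≤ 3 * e ∨ m ≤ countOn (· ∈ L \ {z}) x := by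
  have h1 : e ≤ 3 * e := le_mul_of_one_le_left' (by norm_num)
  have he1 : e ≤ 1 := h1.trans he
  rcases le_or_gt (D.toOuterMeasure L) (3 * e) with hL | hL
  · have hu := toOuterMeasure_univ D
    exact ⟨Set.univ, Set.univ, Set.univ, hu ▸ he1, hu ▸ he1, hu ▸ he1, fun m x _ _ _ =>
      ⟨Or.inl hL, fun z => Or.inl ((D.toOuterMeasure.mono Set.sdiff_subset).trans hL)⟩⟩
  have hm : ∀ {n : ℕ} {m : ℕ} {x : Fin n → X} {A : Set X} {z : X}, A ⊆ L → z ∉ A →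
      m ≤ countOn (· ∈ A) x → m ≤ countOn (· ∈ L \ {z}) x := by
    intro n m x A z hA hz h
    refine h.trans (countOn_mono fun i hi => ⟨hA hi, ?_⟩)
    intro h2
    rw [Set.mem_singleton_iff] at h2
    exact hz (h2 ▸ hi)
  rcases exists_disjoint_or_singleton D he0 hL with
    ⟨A, hA, B, hB, hAB, hAe, hBe⟩ | ⟨w, hw, hwe, hLw⟩
  -- No `z` lies in both `A` and `B`, so one of them survives the deletion of `z`.
  · refine ⟨L, A, B, h1.trans hL.le, hAe, hBe, fun m x h2 h3 h4 => ⟨Or.inr h2, fun z => ?_⟩⟩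
    by_cases hz : z ∈ A
    · exact Or.inr (hm hB (Set.disjoint_left.1 hAB hz) h4)
    · exact Or.inr (hm hA hz h3)
  -- Deleting `w` leaves a light set; deleting any other point keeps the heavy point `w`.
  · refine ⟨L, {w}, {w}, h1.trans hL.le, hwe, hwe, fun m x h2 h3 _ => ⟨Or.inr h2, fun z => ?_⟩⟩
    by_cases hz : z = w
    · exact Or.inl (hz ▸ hLw)
    · exact Or.inr (hm (Set.singleton_subset_iff.2 hw) hz h3)

/-! ### Accuracy of the learner -/

/-- The points of the line `y = h.1 * x + h.2`. -/
def linePoints {F : Type*} [Field F] (h : F × F) : Set (F × F) := {x | h.1 * x.1 + h.2 = x.2}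

theorem lineIndicator_eq_true_iff {F : Type*} [Field F] {h x : F × F} :
    lineIndicator h x = true ↔ x ∈ linePoints h := by
  simp [lineIndicator, linePoints]

theorem linePoints_inter_subsingleton {F : Type*} [Field F] {h k : F × F} (hne : h ≠ k) :
    (linePoints h ∩ linePoints k).Subsingleton := by
  rintro ⟨x, y⟩ ⟨hx, hx'⟩ ⟨u, v⟩ ⟨hu, hu'⟩
  simp only [linePoints, Set.mem_ofPred_eq] at hx hx' hu hu'
  have h1 : (h.1 - k.1) * (x - u) = 0 := by linear_combination hx - hx' - hu + hu'
  rcases mul_eq_zero.1 h1 with h2 | h2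
  · refine absurd (Prod.ext (sub_eq_zero.1 h2) ?_) hne
    linear_combination hx - hx' - x * h2
  · have hxu := sub_eq_zero.1 h2
    subst hxu
    rw [← hx, ← hu]

/-- The point to delete is the intersection with the true line, if there is one; all positive
examples lie on the true line. -/
theorem lineScore_eq_zero {F : Type*} [Field F] {n : ℕ} (x : Fin n → F × F) {h k : F × F}
    (hne : k ≠ h) : lineScore (labelSample (lineIndicator h) x) k = 0 := by
  obtain ⟨z, hz⟩ : ∃ z, linePoints h ∩ linePoints k ⊆ {z} := by
    rcases (linePoints_inter_subsingleton hne.symm).eq_empty_or_singleton with h1 | ⟨z, h1⟩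
    · exact ⟨0, by simp [h1]⟩
    · exact ⟨z, h1.subset⟩
  refine Nat.eq_zero_of_le_zero ((ciInf_le (OrderBot.bddBelow _) z).trans ?_)
  refine (countOn_eq_zero fun i => ?_).le
  rintro ⟨h1, h2, h3⟩
  exact h3 (hz ⟨lineIndicator_eq_true_iff.1 h1, h2⟩)

theorem exists_countOn_le_lineScore {F : Type*} [Field F] {n : ℕ} (x : Fin n → F × F)
    (h : F × F) : ∃ z, countOn (· ∈ linePoints h \ {z}) x ≤
      lineScore (labelSample (lineIndicator h) x) h := by
  obtain ⟨z, hz⟩ := ciInf_mem fun z : F × F =>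
    countOn (fun e => e.2 = true ∧ h.1 * e.1.1 + h.2 = e.1.2 ∧ e.1 ≠ z)
      (labelSample (lineIndicator h) x)
  refine ⟨z, ?_⟩
  rw [lineScore, ← hz]
  refine countOn_mono fun i hi => ?_
  exact ⟨lineIndicator_eq_true_iff.2 hi.1, hi.1, hi.2⟩

theorem pointScore_labelSample {F : Type*} [Field F] {n : ℕ} (x : Fin n → F × F) (h z : F × F) :
    pointScore (labelSample (lineIndicator h) x) z =
      countOn (fun y => y ∈ linePoints h ∧ y = z) x := by
  refine le_antisymm (countOn_mono fun i hi => ?_) (countOn_mono fun i hi => ?_)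
  · exact ⟨lineIndicator_eq_true_iff.1 hi.1, hi.2⟩
  · exact ⟨lineIndicator_eq_true_iff.2 hi.1, hi.2⟩

theorem lineLearner_support_accurate {F : Type*} [Field F] [Finite F] {n T : ℕ} {a c : ℝ}
    (hc : 0 < c) (ha : 0 ≤ a) (hT : ∀ d, T ≤ d → releaseProb a c d = 1) (h : F × F)
    (D : PMF (F × F)) (x : Fin n → F × F) {e : ℝ≥0∞}
    (h1 : D.toOuterMeasure (linePoints h) ≤ e ∨ 3 * T ≤ countOn (· ∈ linePoints h) x)
    (h2 : ∀ z, D.toOuterMeasure (linePoints h \ {z}) ≤ e ∨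
      3 * T ≤ countOn (· ∈ linePoints h \ {z}) x) :
    (lineLearner F n a hc (labelSample (lineIndicator h) x)).support ⊆
      {g | predictionError D (lineIndicator h) g ≤ e} := by
  intro g hg
  rw [Set.mem_ofPred_eq, predictionError]
  have hpos : ∀ {d}, releaseProb a c d ≠ 0 → 0 < d := fun {d} hd => by
    by_contra h0
    exact hd (releaseProb_eq_zero ha hc (by omega))
  have hT0 : 0 < T := hpos (by rw [hT T le_rfl]; norm_num)
  set S := labelSample (lineIndicator h) x with hS
  rcases mem_of_mem_support_mixPure _ hg with ⟨hr, rfl⟩ | ⟨hr, hg⟩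
  -- A wrong winner would have score 0, hence no positive margin, and would not be released.
  · have hw : winner (lineScore S) = h := by
      by_contra hne
      have h3 := add_margin_le n (lineScore S) (Ne.symm hne)
      have h4 := hpos hr
      rw [lineScore_eq_zero x hne] at h3
      omega
    rw [hw]
    simp
  · obtain ⟨z, hz⟩ := exists_countOn_le_lineScore x h
    rw [← hS] at hz
    -- A score of `T` or more would have made the release of the line certain.
    have hzT : countOn (· ∈ linePoints h \ {z}) x < T := by
      by_contra! h3
      have hw : winner (lineScore S) = h := winner_eq fun k hk => by
        rw [lineScore_eq_zero x hk]; omega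
      refine hr (hT _ (le_margin (h3.trans (countOn_le _ x)) fun k hk => ?_))
      rw [hw] at hk ⊢
      rw [lineScore_eq_zero x hk]; omega
    have hDz := (h2 z).resolve_right (by omega)
    -- With `3 * T` examples on the line and fewer than `T` of them away from `z`, more than `2 * T`
    -- sit at `z` and fewer than `T` at any other point.
    have key : D.toOuterMeasure (linePoints h) ≤ e ∨
        (winner (pointScore S) = z ∧ T ≤ margin n (pointScore S)) := by
      refine h1.imp_right fun h3 => ?_
      have hz1 : countOn (· ∈ linePoints h) x ≤
          countOn (· ∈ linePoints h \ {z}) x + pointScore S z := by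
        rw [hS, pointScore_labelSample]
        refine countOn_le_add x fun i hi => ?_
        by_cases hiz : x i = z
        · exact Or.inr ⟨hi, hiz⟩
        · exact Or.inl ⟨hi, hiz⟩
      have hk1 : ∀ k, k ≠ z → pointScore S k ≤ countOn (· ∈ linePoints h \ {z}) x := by
        intro k hk
        rw [hS, pointScore_labelSample]
        exact countOn_mono fun i hi => ⟨hi.1, fun h4 => hk (hi.2.symm.trans h4)⟩
      have hw : winner (pointScore S) = z := winner_eq fun k hk => by
        have := hk1 k hk
        omega
      have hn := countOn_le (· ∈ linePoints h) x
      refine ⟨hw, le_margin (by omega) fun k hk => ?_⟩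
      rw [hw] at hk ⊢
      have := hk1 k hk
      omega
    rcases mem_of_mem_support_mixPure _ hg with ⟨hr', rfl⟩ | ⟨hr', hg⟩
    -- A point off the line has score 0 and cannot have a positive margin. Lying on the line, the
    -- released point errs only on the rest of it.
    · have hmem : winner (pointScore S) ∈ linePoints h := by
        by_contra hne
        have h0 : pointScore S (winner (pointScore S)) = 0 := by
          conv_lhs => rw [hS, pointScore_labelSample]
          exact countOn_eq_zero fun i hi => hne (hi.2 ▸ hi.1)
        obtain ⟨k, hk⟩ := exists_ne (winner (pointScore S))
        have h3 := add_margin_le n (pointScore S) hk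
        have h4 := hpos hr'
        omega
      have hDw : D.toOuterMeasure (linePoints h \ {winner (pointScore S)}) ≤ e := by
        rcases key with h3 | ⟨h3, -⟩
        · exact (D.toOuterMeasure.mono Set.sdiff_subset).trans h3
        · rwa [h3]
      refine le_trans (D.toOuterMeasure.mono fun y hy => ?_) hDw
      rw [Set.mem_ofPred_eq] at hy
      have hyw : y ≠ winner (pointScore S) := by
        rintro rfl
        exact hy (by simpa [pointIndicator] using lineIndicator_eq_true_iff.2 hmem)
      refine ⟨?_, hyw⟩
      rw [← lineIndicator_eq_true_iff]
      simpa [pointIndicator, hyw] using hy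
    · have hL := key.resolve_right fun h3 => hr' (hT _ h3.2)
      rw [PMF.support_pure, Set.mem_singleton_iff] at hg
      subst hg
      refine le_trans (D.toOuterMeasure.mono fun y hy => ?_) hL
      rw [← lineIndicator_eq_true_iff]
      simpa using hy

theorem exists_eq_lineIndicator {p : ℕ} [Fact p.Prime] {f : ZMod p × ZMod p → Bool}
    (hf : f ∈ LineClass p) : ∃ h, f = lineIndicator h := by
  obtain ⟨a, b, hab⟩ := hf
  refine ⟨(a, b), funext fun x => ?_⟩
  rw [Bool.eq_iff_iff, hab x.1 x.2, lineIndicator_eq_true_iff]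
  rfl

/-- On a good sample every hypothesis in the support is accurate, so failure comes only from the
sample: three Chernoff events of probability at most `δ / 3`. -/
theorem lineLearner_isPACLearner {p : ℕ} [Fact p.Prime] {n T : ℕ} {a c ε δ : ℝ}
    (hc : 0 < c) (ha : 0 ≤ a) (hT : ∀ d, T ≤ d → releaseProb a c d = 1) (hε : 0 < ε)
    (hε1 : ε ≤ 1) (hn : 2 ^ (3 * T) * Real.exp (-(n * (ε / 3) / 2)) ≤ δ / 3) :
    IsPACLearner ε δ (LineClass p) (lineLearner (ZMod p) n a hc) := by
  intro f hf D
  obtain ⟨h, rfl⟩ := exists_eq_lineIndicator hf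
  have h3 : 3 * ENNReal.ofReal (ε / 3) = ENNReal.ofReal ε := by
    rw [← ENNReal.ofReal_ofNat 3, ← ENNReal.ofReal_mul (by norm_num)]
    congr 1
    ring
  obtain ⟨A, B, C, hA, hB, hC, hABC⟩ := exists_witness_sets D (linePoints h)
    (e := ENNReal.ofReal (ε / 3)) (by rw [h3]; simpa using hε1)
    (by rw [ne_eq, ENNReal.ofReal_eq_zero]; linarith)
  set bad : Set (ZMod p × ZMod p) → Set (Fin n → ZMod p × ZMod p) :=
    fun E => {x | countOn (· ∈ E) x < 3 * T} with hbad
  have hle : ∀ E, ENNReal.ofReal (ε / 3) ≤ D.toOuterMeasure E →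
      (iidSample D n).toOuterMeasure (bad E) ≤ ENNReal.ofReal (δ / 3) := fun E hE =>
    (iidSample_countOn_lt_le D n (3 * T) (by positivity) hE).trans (ENNReal.ofReal_le_ofReal hn)
  have hδ : 0 ≤ δ / 3 := le_trans (by positivity) hn
  set good : Set (Fin n → ZMod p × ZMod p) := {x | 3 * T ≤ countOn (· ∈ A) x ∧
    3 * T ≤ countOn (· ∈ B) x ∧ 3 * T ≤ countOn (· ∈ C) x} with hgood
  have hmass : ENNReal.ofReal (1 - δ) ≤ (iidSample D n).toOuterMeasure good := by
    have h4 : (1 : ℝ≥0∞) ≤ (iidSample D n).toOuterMeasure good + ENNReal.ofReal δ := by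
      calc (1 : ℝ≥0∞) = (iidSample D n).toOuterMeasure Set.univ := (toOuterMeasure_univ _).symm
        _ ≤ (iidSample D n).toOuterMeasure (good ∪ (bad A ∪ (bad B ∪ bad C))) := by
            refine (iidSample D n).toOuterMeasure.mono fun x _ => ?_
            simp only [hgood, hbad, Set.mem_union, Set.mem_ofPred_eq]
            omega
        _ ≤ (iidSample D n).toOuterMeasure good + ((iidSample D n).toOuterMeasure (bad A) +
              ((iidSample D n).toOuterMeasure (bad B) +
                (iidSample D n).toOuterMeasure (bad C))) := by
            refine (MeasureTheory.measure_union_le _ _).trans (add_le_add le_rfl ?_)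
            refine (MeasureTheory.measure_union_le _ _).trans (add_le_add le_rfl ?_)
            exact MeasureTheory.measure_union_le _ _
        _ ≤ (iidSample D n).toOuterMeasure good + (ENNReal.ofReal (δ / 3) +
              (ENNReal.ofReal (δ / 3) + ENNReal.ofReal (δ / 3))) :=
            add_le_add le_rfl (add_le_add (hle A hA) (add_le_add (hle B hB) (hle C hC)))
        _ = _ := by
            rw [← ENNReal.ofReal_add hδ hδ, ← ENNReal.ofReal_add hδ (by linarith)]
            congr 2
            ring
    rw [ENNReal.ofReal_sub _ (by linarith), ENNReal.ofReal_one]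
    exact tsub_le_iff_right.2 h4
  refine hmass.trans ?_
  rw [outputLaw, PMF.toOuterMeasure_bind_apply, PMF.toOuterMeasure_apply]
  refine ENNReal.tsum_le_tsum fun x => ?_
  by_cases hx : x ∈ good
  · rw [Set.indicator_of_mem hx]
    obtain ⟨h5, h6⟩ := hABC (3 * T) x hx.1 hx.2.1 hx.2.2
    rw [h3] at h5
    simp only [h3] at h6
    rw [((lineLearner (ZMod p) n a hc _).toOuterMeasure_apply_eq_one_iff _).2
      (lineLearner_support_accurate hc ha hT h D x h5 h6), mul_one]
  · rw [Set.indicator_of_notMem hx]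
    exact bot_le

/-! ### Choice of the parameters -/

theorem half_le_log_one_div {x : ℝ} (hx : x ∈ Set.Ioo (0 : ℝ) (1 / 2)) :
    1 / 2 ≤ Real.log (1 / x) ∧ Real.log 2 ≤ Real.log (1 / x) := by
  have h1 : Real.log 2 ≤ Real.log (1 / x) := by
    refine Real.log_le_log (by norm_num) ?_
    rw [le_div_iff₀ hx.1]
    linarith [hx.2]
  exact ⟨by linarith [Real.log_two_gt_d9], h1⟩

theorem log_div_le {x C : ℝ} {k : ℕ} (hC : 0 < C) (hCk : C ≤ 2 ^ k)
    (hx : x ∈ Set.Ioo (0 : ℝ) (1 / 2)) :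
    Real.log (C / x) ≤ (k + 1) * Real.log (1 / x) := by
  have h1 : Real.log C ≤ k * Real.log 2 := by
    rw [← Real.log_pow]
    exact Real.log_le_log hC hCk
  have h2 := mul_le_mul_of_nonneg_left (half_le_log_one_div hx).2 (Nat.cast_nonneg (α := ℝ) k)
  rw [div_eq_mul_one_div, Real.log_mul hC.ne' (one_div_pos.2 hx.1).ne']
  linarith

/-- With 2 ≤ e it suffices that n ε / 6 ≥ 3 T + log(3/δ), and log(3/δ) ≤ 3 log(1/δ); this is where
18 comes from. -/
theorem two_pow_mul_exp_le {n T : ℕ} {ε δ : ℝ} (hε : 0 < ε) (hδ : δ ∈ Set.Ioo (0 : ℝ) (1 / 2))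
    (hn : 18 * (T + Real.log (1 / δ)) / ε ≤ n) :
    2 ^ (3 * T) * Real.exp (-(n * (ε / 3) / 2)) ≤ δ / 3 := by
  have h1 := log_div_le (k := 2) (C := 3) (by norm_num) (by norm_num) hδ
  have hδ0 := hδ.1
  rw [div_le_iff₀ hε] at hn
  have h2 : (2 : ℝ) ≤ Real.exp 1 := by linarith [Real.add_one_le_exp (1 : ℝ)]
  calc (2 : ℝ) ^ (3 * T) * Real.exp (-(n * (ε / 3) / 2))
      ≤ Real.exp 1 ^ (3 * T) * Real.exp (-(n * (ε / 3) / 2)) := by gcongr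
    _ = Real.exp ((3 * T : ℕ) * 1 + -(n * (ε / 3) / 2)) := by
        rw [Real.exp_add, Real.exp_nat_mul]
    _ ≤ Real.exp (-Real.log (3 / δ)) := by
        refine Real.exp_le_exp.2 ?_
        push_cast at h1 ⊢
        linarith
    _ = δ / 3 := by
        rw [Real.exp_neg, Real.exp_log (by positivity), inv_div]

theorem mainTheorem6 :
    ∃ K : ℝ, 0 < K ∧
      ∀ (p : ℕ) [Fact p.Prime] (ε δ α β : ℝ),
        ε ∈ Set.Ioo (0 : ℝ) (1 / 2) → δ ∈ Set.Ioo (0 : ℝ) (1 / 2) →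
        α ∈ Set.Ioo (0 : ℝ) (1 / 2) → β ∈ Set.Ioo (0 : ℝ) (1 / 2) →
        ∃ n : ℕ,
          (n : ℝ) ≤ K * (1 / (ε * α) * Real.log (1 / β) * Real.log (1 / δ)) ∧
          ∃ A : Learner (ZMod p × ZMod p) n,
            IsDifferentiallyPrivate α β A ∧ IsPACLearner ε δ (LineClass p) A := by
  refine ⟨2000, by norm_num, fun p _ ε δ α β hε hδ hα hβ => ?_⟩
  obtain ⟨hε0, hε1⟩ := hε
  obtain ⟨hα0, hα1⟩ := hα
  have hβ0 := hβ.1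
  have hβ1 := hβ.2
  have hM := (half_le_log_one_div hδ).1
  have hB := (half_le_log_one_div hβ).1
  set M := Real.log (1 / δ)
  set B := Real.log (1 / β) with hBdef
  -- The privacy bounds `4 * a` and `10 * c` dictate a = α/4 and c = β/10. As log(10/β) ≤ 5 B, the
  -- certainty threshold is at most 2 + 2 * 5 B / (α/4).
  set T := ⌈2 + 40 * (B / α)⌉₊ with hTdef
  have hc : 0 < β / 10 := by positivity
  have hT : ∀ d, T ≤ d → releaseProb (α / 4) (β / 10) d = 1 := by
    intro d hd
    refine releaseProb_eq_one (by positivity) hc (by linarith) ?_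
    have h1 : Real.log (10 / β) ≤ 5 * B := by
      have := log_div_le (k := 4) (C := 10) (by norm_num) (by norm_num) hβ
      norm_num at this ⊢
      simpa [hBdef] using this
    rw [one_div_div]
    calc 2 + 2 * Real.log (10 / β) / (α / 4) ≤ 2 + 2 * (5 * B) / (α / 4) := by gcongr
      _ = 2 + 40 * (B / α) := by
          field_simp
          ring
      _ ≤ T := Nat.le_ceil _
      _ ≤ d := by exact_mod_cast hd
  refine ⟨⌈18 * (T + M) / ε⌉₊, ?_, lineLearner (ZMod p) _ (α / 4) hc, ?_, ?_⟩
  · have hΛ : 1 ≤ B / α := by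
      rw [le_div_iff₀ hα0]
      linarith
    have hT' : (T : ℝ) ≤ 43 * (B / α) := by
      have := (Nat.ceil_lt_add_one (a := 2 + 40 * (B / α)) (by positivity)).le
      linarith
    have hn := (Nat.ceil_lt_add_one (a := 18 * (T + M) / ε) (by positivity)).le
    refine hn.trans ?_
    have h1 : 2000 * (1 / (ε * α) * B * M) = 2000 * (B / α * M) / ε := by
      field_simp
    rw [h1, ← sub_nonneg]
    have h2 : 2000 * (B / α * M) / ε - (18 * (T + M) / ε + 1) =
        (2000 * (B / α * M) - 18 * (T + M) - ε) / ε := by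
      field_simp
      ring
    rw [h2]
    refine div_nonneg ?_ hε0.le
    -- Since B/α ≥ 1 and M ≥ 1/2, the terms 18 T, 18 M and ε are at most 1548, 18 and 1 times (B/α)
    -- M.
    nlinarith
  · have hexp : Real.exp (2 * (α / 4)) ≤ 2 := by
      rw [← Real.le_log_iff_exp_le (by norm_num)]
      linarith [Real.log_two_gt_d9]
    have := lineLearner_isDifferentiallyPrivate (ZMod p) ⌈18 * (T + M) / ε⌉₊ hc
      (a := α / 4) (by positivity) hexp (by linarith)
    rwa [mul_div_cancel₀ _ (by norm_num), mul_div_cancel₀ _ (by norm_num)] at this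
  · exact lineLearner_isPACLearner hc (by positivity) hT hε0 (by linarith)
      (two_pow_mul_exp_le hε0 hδ (Nat.le_ceil _))
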